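/- A bidirected graph $B=(G,\sigma)$ is a loopless multigraph $G=(V,E)$ together with a sign $\sigma(e,u)\in\{+,-\}$ for every edge $e$ and every endpoint $u$ of $e$. An oriented edge $\vec e=(e,u,v)$ is an edge $e$ with endpoints $u,v$, viewed as directed from its tail $u$ to its head $v$; every edge has exactly two orientations. A $v_0$–$v_\ell$ trail in $B$ is a sequence $v_0\vec e_1v_1\vec e_2v_2\dots\vec e_\ell v_\ell$ ($\ell\ge 0$) of vertices and oriented edges in which the underlying edges $e_1,\dots,e_\ell$ are distinct, $\vec e_i$ has tail $v_{i-1}$ and head $v_i$ for $1\le i\le\ell$, and $\sigma(e_{i+1},v_i)=-\sigma(e_i,v_i)$ for $1\le i<\ell$. A path is a trail that does not repeat vertices. Two trails are edge-disjoint if no edge has an orientation appearing in each of them. Let $B$ be rooted at a vertex $r$. An edge $e$ is trail-directable if there is exactly one orientation $\vec e$ of $e$ such that $B$ contains a trail that starts in $r$, has no internal vertex equal to $r$ (that is, $v_i\neq r$ for $1\le i<\ell$), and has $\vec e$ as its terminal oriented edge. The rooted bidirected graph $B$ is edge-clean if every edge incident with $r$ is trail-directable. **Theorem.** Let $B$ be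 an edge-clean bidirected graph rooted at $r$, let $x\in V(B)\setminus\{r\}$, and let $\mathcal P$ and $\mathcal Q$ be sets of pairwise edge-disjoint $r$–$x$ paths in $B$. Then there is a set $\mathcal R$ of pairwise edge-disjoint $r$–$x$ paths in $B$ such that the first edge of every path in $\mathcal P$ is the first edge of some path in $\mathcal R$, and the last edge of every path in $\mathcal Q$ is the last edge of some path in $\mathcal R$. -/

import Mathlib

/-- A bidirected graph with vertex set `V` and edge set `E`: a loopless multigraph together with a
sign `+1` or `-1` (an element of `ℤˣ`) for every half-edge. For convenience `sign` is a total
function; only its values `sign e u` at endpoints `u` of `e` are ever used. -/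
structure BidirectedGraph (V : Type*) (E : Type*) where
  ends : E → Sym2 V
  loopless : ∀ e, ¬ (ends e).IsDiag
  sign : E → V → ℤˣ

namespace BidirectedGraph

/-- An oriented edge `(e, u, v)`: an edge `e` with endpoints `u` (its tail) and `v` (its head). -/
@[ext]
structure OrientedEdge {V E : Type*} (B : BidirectedGraph V E) where
  edge : E
  tail : V
  head : V
  ends_eq : B.ends edge = s(tail, head)

/-- `B.Joins u L v`: the list `L` of oriented edges leads from `u` to `v`, each oriented edge
starting where the previous one ends. -/
def Joins {V E : Type*} (B : BidirectedGraph V E) : V → List B.OrientedEdge → V → Prop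
  | u, [], v => u = v
  | u, a :: L, v => a.tail = u ∧ B.Joins a.head L v

/-- A `u`--`v` trail: no edge is used twice (in whichever orientation), and consecutive edges have
opposite signs at the vertex in between. The empty list of steps gives the trivial trail. -/
@[ext]
structure Trail {V E : Type*} (B : BidirectedGraph V E) (u v : V) where
  steps : List B.OrientedEdge
  joins : B.Joins u steps v
  alternates : steps.IsChain (fun a b => B.sign b.edge a.head = - B.sign a.edge a.head)
  edges_nodup : (steps.map OrientedEdge.edge).Nodup

namespace Trail

/-- The sequence of vertices of a trail. -/
def support {V E : Type*} {B : BidirectedGraph V E} {u v : V} (T : B.Trail u v) : List V :=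
  u :: T.steps.map OrientedEdge.head

/-- The sequence of internal vertices of a trail: all vertices except the initial and the terminal
entry of the sequence. -/
def internal {V E : Type*} {B : BidirectedGraph V E} {u v : V} (T : B.Trail u v) : List V :=
  T.steps.dropLast.map OrientedEdge.head

/-- The set `E(T)` of edges of a trail. -/
def edgeSet {V E : Type*} {B : BidirectedGraph V E} {u v : V} (T : B.Trail u v) : Set E :=
  {e | ∃ a ∈ T.steps, a.edge = e}

/-- A path is a trail that does not repeat vertices. -/
def IsPath {V E : Type*} {B : BidirectedGraph V E} {u v : V} (T : B.Trail u v) : Prop :=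
  T.support.Nodup

end Trail

/-- The root `r` reaches the oriented edge `a` if there is an `r`--`a` trail: a trail starting
in `r`, with no internal vertex equal to `r`, whose terminal oriented edge is `a`. -/
def TrailReaches {V E : Type*} (B : BidirectedGraph V E) (r : V) (a : B.OrientedEdge) : Prop :=
  ∃ T : B.Trail r a.head, r ∉ T.internal ∧ T.steps.getLast? = some a

/-- An edge is trail-directable if exactly one of its two orientations `a` admits an
`r`--`a` trail. -/
def TrailDirectable {V E : Type*} (B : BidirectedGraph V E) (r : V) (e : E) : Prop :=
  ∃! a : B.OrientedEdge, a.edge = e ∧ B.TrailReaches r a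

/-- `B`, rooted at `r`, is edge-clean if all edges incident with `r` are trail-directable. -/
def EdgeClean {V E : Type*} (B : BidirectedGraph V E) (r : V) : Prop :=
  ∀ e, r ∈ B.ends e → B.TrailDirectable r e

/-- A set of pairwise edge-disjoint `u`--`v` paths. -/
def IsEdgeDisjointPaths {V E : Type*} (B : BidirectedGraph V E) {u v : V}
    (P : Set (B.Trail u v)) : Prop :=
  (∀ T ∈ P, T.IsPath) ∧ P.PairwiseDisjoint Trail.edgeSet

/-- The set of first edges of the (nontrivial) trails in `P`. -/
def firstEdges {V E : Type*} (B : BidirectedGraph V E) {u v : V} (P : Set (B.Trail u v)) : Set E :=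
  {e | ∃ T ∈ P, ∃ a ∈ T.steps.head?, a.edge = e}

/-- The set of last edges of the (nontrivial) trails in `P`. -/
def lastEdges {V E : Type*} (B : BidirectedGraph V E) {u v : V} (P : Set (B.Trail u v)) : Set E :=
  {e | ∃ T ∈ P, ∃ a ∈ T.steps.getLast?, a.edge = e}

end BidirectedGraph

/-! Call an oriented edge one-way if `r` reaches it but not its reverse. The new paths follow a path
of `P` up to a one-way edge and continue along a path of `Q`; which paths are joined, and where, is
decided by a stable matching of `P` with `Q`.

The candidates are the one-way edges lying on a path of both families. A path of `P` prefers early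
candidates, a path of `Q` late ones. Ranks are natural numbers because paths are finite, so the
families themselves may be infinite. Stability says that each candidate has a chosen edge weakly
before it on its `P`-path or weakly after it on its `Q`-path. If an edge lies on a kept initial
piece and on a kept final piece and is one-way, this forces it to be a chosen edge itself.

Edges reachable in both orientations are handled by bottlenecks (`exists_base`): the last one-way
edge before such an edge on a root trail lies on every root trail to it, in either orientation.
Edge-cleanness makes the first edge of a root trail one-way, so a bottleneck exists. Stability at
the bottleneck then rules out the clash (`exists_switching`).

The joined trails may still repeat vertices; `RootPath.merge` shortcuts them, keeping both end
edges. Paths without a chosen edge are kept whole. -/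

/-! ### Stable matchings by a fixed point argument -/

/-- The elements of `A` that are not the best of `A` in their fibre. -/
def dominated {X I : Type*} (p : X → I) (m : X → ℕ) (A : Set X) : Set X :=
  {f | f ∈ A ∧ ∃ g ∈ A, p g = p f ∧ m g < m f}

lemma dominated_mono {X I : Type*} (p : X → I) (m : X → ℕ) : Monotone (dominated p m) :=
  fun _ _ h _ ⟨hf, g, hg, h1⟩ => ⟨h hf, g, h hg, h1⟩

lemma exists_undominated {X I : Type*} (p : X → I) (m : X → ℕ) {A : Set X} {f : X} (hf : f ∈ A) :
    ∃ g ∈ A, g ∉ dominated p m A ∧ p g = p f ∧ m g ≤ m f := by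
  induction h : m f using Nat.strong_induction_on generalizing f with
  | _ k ih =>
    by_cases hd : f ∈ dominated p m A
    · obtain ⟨_, g, hg, hp, hm⟩ := hd
      obtain ⟨g', h1, h2, h3, h4⟩ := ih (m g) (h ▸ hm) hg rfl
      exact ⟨g', h1, h2, h3.trans hp, by omega⟩
    · exact ⟨f, hf, hd, rfl, h.le⟩

/-- Stable matchings exist: `X` is the edge set of a bipartite graph, every vertex of which ranks
its edges by natural numbers. -/
theorem exists_stable_matching {X I J : Type*} (p : X → I) (q : X → J) (m n : X → ℕ)
    (hm : ∀ s t, p s = p t → m s = m t → s = t) (hn : ∀ s t, q s = q t → n s = n t → s = t) :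
    ∃ S : Set X, (∀ s ∈ S, ∀ t ∈ S, p s = p t → s = t) ∧ (∀ s ∈ S, ∀ t ∈ S, q s = q t → s = t) ∧
      ∀ f, (∃ s ∈ S, p s = p f ∧ m s ≤ m f) ∨ (∃ s ∈ S, q s = q f ∧ n s ≤ n f) := by
  -- Rejection is monotone and is complemented twice, so Knaster–Tarski applies. At a fixed point,
  -- `A` is what the `q` side does not reject from `C`, and `C` is what the `p` side does not reject
  -- from `A`; the matching is `A ∩ C`.
  let F : Set X →o Set X :=
    ⟨fun A => (dominated q n (dominated p m A)ᶜ)ᶜ, fun _ _ h =>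
      Set.compl_subset_compl.2 (dominated_mono q n
        (Set.compl_subset_compl.2 (dominated_mono p m h)))⟩
  obtain ⟨A, hA⟩ : ∃ A, F A = A := ⟨_, F.map_lfp⟩
  have hA : (dominated q n (dominated p m A)ᶜ)ᶜ = A := hA
  set C := (dominated p m A)ᶜ with hC
  have hmem : ∀ f, f ∈ A ↔ f ∉ dominated q n C := fun f => by rw [← Set.mem_compl_iff, hA]
  refine ⟨A ∩ C, ?_, ?_, ?_⟩
  · rintro s ⟨hs, hs'⟩ t ⟨ht, ht'⟩ hst
    rcases lt_trichotomy (m s) (m t) with h | h | h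
    · exact absurd ⟨ht, s, hs, hst, h⟩ ht'
    · exact hm _ _ hst h
    · exact absurd ⟨hs, t, ht, hst.symm, h⟩ hs'
  · rintro s ⟨hs, hs'⟩ t ⟨ht, ht'⟩ hst
    rcases lt_trichotomy (n s) (n t) with h | h | h
    · exact absurd ⟨ht', s, hs', hst, h⟩ ((hmem t).1 ht)
    · exact hn _ _ hst h
    · exact absurd ⟨hs', t, ht', hst.symm, h⟩ ((hmem s).1 hs)
  · intro f
    by_cases hf : f ∈ A
    · obtain ⟨g, h1, h2, h3, h4⟩ := exists_undominated p m hf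
      exact Or.inl ⟨g, ⟨h1, h2⟩, h3, h4⟩
    · have hf' : f ∈ dominated q n C := not_not.1 (fun h => hf ((hmem f).2 h))
      obtain ⟨g, h1, h2, h3, h4⟩ := exists_undominated q n hf'.1
      exact Or.inr ⟨g, ⟨(hmem g).2 h2, h1⟩, h3, h4⟩

/-! ### Oriented edges, reversal and trails from the root -/

namespace BidirectedGraph

open List

variable {V E : Type*} {B : BidirectedGraph V E} {r x : V}

namespace OrientedEdge

/-- The other orientation of an oriented edge. -/
def rev (a : B.OrientedEdge) : B.OrientedEdge :=
  ⟨a.edge, a.head, a.tail, by rw [a.ends_eq, Sym2.eq_swap]⟩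

@[simp] lemma rev_edge (a : B.OrientedEdge) : a.rev.edge = a.edge := rfl
@[simp] lemma rev_tail (a : B.OrientedEdge) : a.rev.tail = a.head := rfl
@[simp] lemma rev_head (a : B.OrientedEdge) : a.rev.head = a.tail := rfl
@[simp] lemma rev_rev (a : B.OrientedEdge) : a.rev.rev = a := rfl

lemma eq_or_eq_rev {a b : B.OrientedEdge} (h : a.edge = b.edge) : a = b ∨ a = b.rev := by
  have h1 := a.ends_eq
  rw [h, b.ends_eq, Sym2.eq_iff] at h1
  rcases h1 with ⟨h1, h2⟩ | ⟨h1, h2⟩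
  · exact Or.inl (OrientedEdge.ext h h1.symm h2.symm)
  · exact Or.inr (OrientedEdge.ext h h2.symm h1.symm)

lemma tail_ne_head (a : B.OrientedEdge) : a.tail ≠ a.head := by
  intro h
  apply B.loopless a.edge
  rw [a.ends_eq, h]
  exact Sym2.mk_isDiag_iff.2 rfl

end OrientedEdge

open OrientedEdge

/-- The edges underlying a list of oriented edges. -/
abbrev edges (L : List B.OrientedEdge) : List E := L.map OrientedEdge.edge

/-- `b` may follow `a` in a trail, without passing through `r`. -/
def Step (r : V) (a b : B.OrientedEdge) : Prop :=
  b.tail = a.head ∧ B.sign b.edge a.head = - B.sign a.edge a.head ∧ a.head ≠ r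

lemma Step.rev {a b : B.OrientedEdge} (h : Step r a b) : Step r b.rev a.rev := by
  obtain ⟨h1, h2, h3⟩ := h
  refine ⟨?_, ?_, ?_⟩
  · simp [h1]
  · simp [h1, h2]
  · simpa [h1] using h3

/-- The reversal of a list of oriented edges. -/
def revList (L : List B.OrientedEdge) : List B.OrientedEdge := (L.map OrientedEdge.rev).reverse

@[simp] lemma revList_nil : revList ([] : List B.OrientedEdge) = [] := rfl

@[simp] lemma revList_cons (a : B.OrientedEdge) (L : List B.OrientedEdge) :
    revList (a :: L) = revList L ++ [a.rev] := by simp [revList]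

@[simp] lemma revList_append (L M : List B.OrientedEdge) :
    revList (L ++ M) = revList M ++ revList L := by simp [revList]

@[simp] lemma edges_revList (L : List B.OrientedEdge) : edges (revList L) = (edges L).reverse := by
  simp [revList, edges, Function.comp_def]

lemma isChain_revList {L : List B.OrientedEdge} (h : L.IsChain (Step r)) :
    (revList L).IsChain (Step r) := by
  rw [revList, isChain_reverse, isChain_map]
  exact h.imp fun _ _ h => h.rev

/-- The list of steps of a trail that starts in `r` and has no internal vertex equal to `r`. -/
structure RootTrail (r : V) (L : List B.OrientedEdge) : Prop where
  chain : L.IsChain (Step r)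
  nodup : (edges L).Nodup
  start : ∀ a ∈ L.head?, a.tail = r

lemma RootTrail.of_append {L M : List B.OrientedEdge} (h : RootTrail r (L ++ M)) :
    RootTrail r L := by
  refine ⟨h.chain.left_of_append, ?_, ?_⟩
  · have := h.nodup
    rw [edges, map_append] at this
    exact this.of_append_left
  · intro a ha
    apply h.start
    cases L <;> simp_all

/-- Admissibility of a step depends only on two consecutive edges, so when trails are spliced at `a`
only distinctness of edges is global. -/
lemma RootTrail.extend {L M : List B.OrientedEdge} {a : B.OrientedEdge}
    (h : RootTrail r (L ++ [a])) (hM : (a :: M).IsChain (Step r))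
    (hn : (edges (L ++ a :: M)).Nodup) : RootTrail r (L ++ a :: M) := by
  refine ⟨isChain_split.2 ⟨h.chain, hM⟩, hn, ?_⟩
  have := h.start
  cases L <;> simp_all

/-- `a` is the last oriented edge of a trail from `r` without internal vertex `r`. -/
def Reach (r : V) (a : B.OrientedEdge) : Prop := ∃ L, RootTrail r (L ++ [a])

lemma RootTrail.reach {L M : List B.OrientedEdge} {a : B.OrientedEdge}
    (h : RootTrail r (L ++ a :: M)) : Reach r a :=
  ⟨L, RootTrail.of_append (M := M) (by simpa using h)⟩

lemma RootTrail.reach_of_mem {L : List B.OrientedEdge} {a : B.OrientedEdge}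
    (h : RootTrail r L) (ha : a ∈ L) : Reach r a := by
  obtain ⟨s, t, rfl⟩ := append_of_mem ha
  exact h.reach

/-! ### Bottlenecks: one-way edges that all trails must use -/

/-- `a` can be reached from `r` without using the edge of `b`. -/
def ReachAvoiding (r : V) (b a : B.OrientedEdge) : Prop :=
  ∃ L, RootTrail r (L ++ [a]) ∧ b.edge ∉ edges (L ++ [a])

lemma _root_.List.exists_first {α : Type*} (p : α → Prop) :
    ∀ L : List α, (∃ a ∈ L, p a) → ∃ s a t, L = s ++ a :: t ∧ p a ∧ ∀ c ∈ s, ¬ p c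
  | [], h => by simp at h
  | b :: L, h => by
    by_cases hb : p b
    · exact ⟨[], b, L, rfl, hb, by simp⟩
    · obtain ⟨s, a, t, rfl, h1, h2⟩ := List.exists_first p L (by
        obtain ⟨a, ha, hp⟩ := h
        rcases mem_cons.1 ha with rfl | ha
        · exact absurd hp hb
        · exact ⟨a, ha, hp⟩)
      refine ⟨b :: s, a, t, rfl, h1, ?_⟩
      intro c hc
      rcases mem_cons.1 hc with rfl | hc
      · exact hb
      · exact h2 c hc

/-- If `b` is reachable in one orientation only and every trail to `f.rev` uses the edge of `b`,
then so does every trail to `f`. -/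
lemma not_reachAvoiding_of_rev {b f : B.OrientedEdge} (hb : ¬ Reach r b.rev)
    (hf : Reach r f.rev) (h : ¬ ReachAvoiding r b f.rev) : ¬ ReachAvoiding r b f := by
  rintro ⟨A, hA, hbA⟩
  obtain ⟨L, hL⟩ := hf
  have hbL : b.edge ∈ edges (L ++ [f.rev]) := by
    by_contra hbL
    exact h ⟨L, hL, hbL⟩
  have hbf : b.edge ≠ f.edge := by
    intro hbf
    exact hbA (by simp [hbf])
  -- The trail to `f.rev` can traverse the edge of `b` only forwards, as `b.rev` is unreachable.
  have hbL' : b ∈ L := by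
    obtain ⟨b', hb', hbe⟩ := mem_map.1 hbL
    rcases eq_or_eq_rev hbe with rfl | rfl
    · rcases mem_append.1 hb' with h' | h'
      · exact h'
      · simp only [mem_singleton] at h'
        exact absurd (by rw [h']; rfl) hbf
    · exact absurd (hL.reach_of_mem hb') hb
  obtain ⟨D0, D', rfl⟩ := append_of_mem hbL'
  -- Follow the trail that avoids `b` until it first meets the part of the other trail after `b`; it
  -- does so at `f` at the latest.
  obtain ⟨S, g, U, hSU, ⟨d, hd, hdg⟩, hS⟩ := List.exists_first
    (fun a : B.OrientedEdge => ∃ d ∈ D' ++ [f.rev], d.edge = a.edge) (A ++ [f])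
    ⟨f, by simp, f.rev, by simp, rfl⟩
  have hSU' : RootTrail r (S ++ g :: U) := hSU ▸ hA
  have hbS : b.edge ∉ edges (S ++ g :: U) := hSU ▸ hbA
  have hSg : RootTrail r (S ++ [g]) := RootTrail.of_append (M := U) (by simpa using hSU')
  obtain ⟨D1, D2, hD⟩ := append_of_mem hd
  have hD' : D0 ++ b :: D' ++ [f.rev] = D0 ++ (b :: D1 ++ d :: D2) := by simp [hD]
  rw [hD'] at hL
  have hc := hL.chain.right_of_append
  have hn : (edges (b :: D1 ++ d :: D2)).Nodup := by
    have := hL.nodup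
    rw [edges, map_append] at this
    exact this.of_append_right
  have hnS := hSg.nodup
  have hS' : ∀ c ∈ S, ∀ d' ∈ D1 ++ d :: D2, d'.edge ≠ c.edge := fun c hcS d' hd' hne =>
    hS c hcS ⟨d', hD ▸ hd', hne⟩
  rcases eq_or_eq_rev hdg with rfl | rfl
  · -- same direction: continue to `f.rev`, avoiding `b`
    have hext : RootTrail r (S ++ d :: D2) := by
      refine hSg.extend hc.right_of_append ?_
      simp only [edges, map_append, map_cons, nodup_append, nodup_cons, mem_cons, mem_map,
        forall_exists_index, and_imp, cons_append, mem_append] at hn hnS hS' ⊢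
      grind
    have hl : d :: D2 = (d :: D2).dropLast ++ [f.rev] := by
      have h2 : (d :: D2).getLast? = some f.rev := by
        have := congrArg getLast? hD
        simpa using this.symm
      rw [← dropLast_append_getLast? _ h2]
      simp
    refine h ⟨S ++ (d :: D2).dropLast, ?_, ?_⟩
    · rw [append_assoc, ← hl]; exact hext
    · rw [append_assoc, ← hl]
      simp only [edges, map_append, map_cons, nodup_append, nodup_cons, mem_cons, mem_map,
        forall_exists_index, and_imp, cons_append, mem_append] at hn hbS ⊢
      grind
  · -- opposite direction: go back to `b`
    have hc2 : (g :: revList (b :: D1)).IsChain (Step r) := by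
      have : (b :: D1 ++ [g.rev]).IsChain (Step r) :=
        IsChain.left_of_append (l₂ := D2) (by simpa using hc)
      simpa using isChain_revList this
    have hext : RootTrail r (S ++ g :: revList (b :: D1)) := by
      refine hSg.extend hc2 ?_
      have he : edges (S ++ g :: revList (b :: D1)) =
        edges S ++ g.edge :: (edges (b :: D1)).reverse := by
          rw [← edges_revList]; simp [edges]
      rw [he]
      simp only [edges, map_append, map_cons, nodup_append, nodup_cons, mem_cons, mem_map,
        forall_exists_index, and_imp, cons_append, mem_append, rev_edge, nodup_reverse,
        mem_reverse] at hn hnS hS' hbS ⊢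
      grind
    refine hb ⟨S ++ g :: revList D1, ?_⟩
    simpa using hext

/-- If `b` is reachable in one orientation only, and is followed on a trail only by edges reachable
in both orientations, the last of which is `f`, then all trails to `f` or `f.rev` use `b`. -/
lemma not_reachAvoiding_of_chain {b : B.OrientedEdge} (hb : ¬ Reach r b.rev)
    (M : List B.OrientedEdge) : ∀ f, (b :: (M ++ [f])).IsChain (Step r) →
      (∀ a ∈ M ++ [f], Reach r a ∧ Reach r a.rev) →
      ¬ ReachAvoiding r b f ∧ ¬ ReachAvoiding r b f.rev := by
  induction M using List.reverseRecOn with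
  | nil =>
    intro f hc hM
    have h1 : ¬ ReachAvoiding r b f.rev := by
      rintro ⟨L, hL, hbL⟩
      apply hb
      refine ⟨L ++ [f.rev], ?_⟩
      -- The step from `b` to `f` reverses to a step from `f.rev` to `b.rev`, which would make
      -- `b.rev` reachable.
      have := hL.extend (M := [b.rev]) (by
        have := isChain_revList hc
        simpa using this) (by
        have hn := hL.nodup
        simp only [edges, map_append, map_cons, nodup_append, nodup_cons] at hn hbL ⊢
        grind [rev_edge])
      simpa using this
    exact ⟨not_reachAvoiding_of_rev hb (hM f (by simp)).2 h1, h1⟩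
  | append_singleton M k ih =>
    intro f hc hM
    have hk := ih k (IsChain.left_of_append (l₂ := [f]) (by simpa using hc))
      (fun a ha => hM a (by
        rw [append_assoc, mem_append] at *; grind))
    have h1 : ¬ ReachAvoiding r b f.rev := by
      rintro ⟨L, hL, hbL⟩
      -- A trail to `f.rev` avoiding `b` either contains a trail to `k` or `k.rev`, or extends by
      -- `k.rev`; both contradict the induction hypothesis.
      by_cases hkL : k.edge ∈ edges (L ++ [f.rev])
      · obtain ⟨k', hk', hke⟩ := mem_map.1 hkL
        obtain ⟨s, t, hst⟩ := append_of_mem hk'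
        have hav : ReachAvoiding r b k' := by
          refine ⟨s, RootTrail.of_append (M := t) (by simpa [hst] using hL), ?_⟩
          rw [hst] at hbL
          simp only [edges, map_append, map_cons] at hbL ⊢
          grind
        rcases eq_or_eq_rev hke with rfl | rfl
        · exact hk.1 hav
        · exact hk.2 hav
      · apply hk.2
        have hc' : [k, f].IsChain (Step r) :=
          IsChain.right_of_append (l₁ := b :: M) (by simpa using hc)
        have hn := hL.nodup
        have hbk : b.edge ≠ k.edge := by
          intro hbk
          have := hM k (by simp)
          rcases eq_or_eq_rev hbk with rfl | rfl
          · exact hb this.2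
          · exact hb this.1
        refine ⟨L ++ [f.rev], ?_, ?_⟩
        · have := hL.extend (M := [k.rev]) (by simpa using isChain_revList hc') (by
            simp only [edges, map_append, map_cons, nodup_append, nodup_cons] at hn hkL ⊢
            grind [rev_edge])
          simpa using this
        · simp only [edges, map_append, map_cons] at hbL ⊢
          grind [rev_edge]
    exact ⟨not_reachAvoiding_of_rev hb (hM f (by simp)).2 h1, h1⟩

/-- No edge at the root is reachable towards the root. -/
def RootClean (B : BidirectedGraph V E) (r : V) : Prop :=
  ∀ a : B.OrientedEdge, a.tail = r → ¬ Reach r a.rev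

/-- If two trails from `r` both use an edge that is reachable in both orientations, then they share
an earlier edge `b` that is reachable in one orientation only; on the first trail, no other such
edge lies between `b` and the given edge. -/
lemma exists_base (hr : RootClean B r) {L L' N N' : List B.OrientedEdge} {f f' : B.OrientedEdge}
    (hL : RootTrail r (L ++ f :: N)) (hL' : RootTrail r (L' ++ f' :: N')) (hff : f'.edge = f.edge)
    (hf : Reach r f.rev) :
    ∃ L0 b M, L = L0 ++ b :: M ∧ ¬ Reach r b.rev ∧ (∀ a ∈ M, Reach r a.rev) ∧ b ∈ L' := by
  -- The first edge of the trail is one-way by `hr`; searching the reversed list picks the one-way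
  -- edge closest to `f`.
  have hne : ∃ a ∈ L.reverse, ¬ Reach r a.rev := by
    cases L with
    | nil => exact absurd hf (hr f (hL.start f (by simp)))
    | cons a L => exact ⟨a, by simp, hr a (hL.start a (by simp))⟩
  obtain ⟨s, b, t, hst, hb, hs⟩ := List.exists_first _ _ hne
  have hLe : L = t.reverse ++ b :: s.reverse := by
    have := congrArg reverse hst
    simpa using this
  have hL1 : RootTrail r (L ++ [f]) := RootTrail.of_append (M := N) (by simpa using hL)
  have hL1' : RootTrail r (L' ++ [f']) := RootTrail.of_append (M := N') (by simpa using hL')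
  have hmem : ∀ a ∈ s.reverse ++ [f], Reach r a ∧ Reach r a.rev := by
    intro a ha
    refine ⟨hL1.reach_of_mem ?_, ?_⟩
    · rw [hLe]; simp only [mem_append, mem_cons] at ha ⊢; grind
    · rcases mem_append.1 ha with ha | ha
      · exact not_not.1 (hs a (by simpa using ha))
      · simp only [mem_singleton] at ha; exact ha ▸ hf
  have hav := not_reachAvoiding_of_chain hb s.reverse f (by
    have := hL1.chain
    rw [hLe, append_assoc] at this
    simpa using this.right_of_append) hmem
  refine ⟨t.reverse, b, s.reverse, hLe, hb, fun a ha => (hmem a (by simp_all)).2, ?_⟩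
  have hbL : b.edge ∈ edges (L' ++ [f']) := by
    by_contra hcon
    rcases eq_or_eq_rev hff with rfl | rfl
    · exact hav.1 ⟨L', hL1', hcon⟩
    · exact hav.2 ⟨L', hL1', hcon⟩
  obtain ⟨b', hb', hbe⟩ := mem_map.1 hbL
  have hbb : b' = b := by
    rcases eq_or_eq_rev hbe with h | rfl
    · exact h
    · exact absurd (hL1'.reach_of_mem hb') hb
  subst hbb
  rcases mem_append.1 hb' with h | h
  · exact h
  · simp only [mem_singleton] at h
    subst h
    rcases eq_or_eq_rev hff with rfl | h'
    · exact absurd hf hb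
    · exact absurd (by rw [h']; exact (hmem f (by simp)).1) hb

/-! ### Paths as lists of steps -/

/-- The list of steps of a nontrivial `r`--`x` path. -/
structure RootPath (r x : V) (L : List B.OrientedEdge) : Prop extends RootTrail r L where
  ne_nil : L ≠ []
  last : ∀ a ∈ L.getLast?, a.head = x
  root_notMem : r ∉ L.map OrientedEdge.head
  heads_nodup : (L.map OrientedEdge.head).Nodup

lemma Joins.head {u v : V} {L : List B.OrientedEdge} (h : B.Joins u L v) :
    ∀ a ∈ L.head?, a.tail = u := by
  cases L with
  | nil => simp
  | cons a L => simpa using h.1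

lemma Joins.last {u v : V} {L : List B.OrientedEdge} (h : B.Joins u L v) :
    ∀ a ∈ L.getLast?, a.head = v := by
  induction L generalizing u with
  | nil => simp
  | cons a L ih =>
    cases L with
    | nil => simpa [Joins] using h.2
    | cons b L => simpa using ih h.2

lemma Joins.isChain_step {u v : V} {L : List B.OrientedEdge} (h : B.Joins u L v)
    (ha : L.IsChain (fun a b => B.sign b.edge a.head = - B.sign a.edge a.head))
    (hr : r ∉ L.dropLast.map OrientedEdge.head) : L.IsChain (Step r) := by
  induction L generalizing u with
  | nil => simp
  | cons a L ih =>
    cases L with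
    | nil => simp
    | cons b L =>
      rw [isChain_cons_cons] at ha ⊢
      simp only [dropLast_cons_cons, map_cons, mem_cons, not_or] at hr
      exact ⟨⟨h.2.1, ha.1, fun h => hr.1 h.symm⟩, ih h.2 ha.2 hr.2⟩

lemma joins_of_isChain {u v : V} {L : List B.OrientedEdge} (hne : L ≠ [])
    (hc : L.IsChain (Step r)) (hu : ∀ a ∈ L.head?, a.tail = u)
    (hv : ∀ a ∈ L.getLast?, a.head = v) : B.Joins u L v := by
  induction L generalizing u with
  | nil => exact absurd rfl hne
  | cons a L ih =>
    refine ⟨hu a (by simp), ?_⟩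
    cases L with
    | nil => exact hv a (by simp)
    | cons b L =>
      rw [isChain_cons_cons] at hc
      exact ih (by simp) hc.2 (by simpa using hc.1.1) (by simpa using hv)

lemma Trail.rootTrail {v : V} (T : B.Trail r v) (h : r ∉ T.internal) : RootTrail r T.steps :=
  ⟨T.joins.isChain_step T.alternates h, T.edges_nodup, T.joins.head⟩

lemma Trail.IsPath.rootPath {T : B.Trail r x} (hT : T.IsPath) (hx : x ≠ r) :
    RootPath r x T.steps := by
  have hT' : (r :: T.steps.map OrientedEdge.head).Nodup := hT
  rw [nodup_cons] at hT'
  refine ⟨T.rootTrail fun h => hT'.1 ?_, ?_, T.joins.last, hT'.1, hT'.2⟩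
  · obtain ⟨a, ha, rfl⟩ := mem_map.1 h
    exact mem_map_of_mem (mem_of_mem_dropLast ha)
  · intro h
    have := T.joins
    rw [h] at this
    exact hx this.symm

lemma RootPath.exists_trail {L : List B.OrientedEdge} (h : RootPath r x L) :
    ∃ T : B.Trail r x, T.steps = L ∧ T.IsPath :=
  ⟨⟨L, joins_of_isChain h.ne_nil h.chain h.start h.last, h.chain.imp fun _ _ h => h.2.1, h.nodup⟩,
    rfl, nodup_cons.2 ⟨h.root_notMem, h.heads_nodup⟩⟩

/-- An edge at `r` is reached outwards by the one-edge trail, so its unique reachable orientation is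
the outward one. -/
lemma EdgeClean.rootClean (h : B.EdgeClean r) : RootClean B r := by
  rintro a ha ⟨L, hL⟩
  have hmem : r ∈ B.ends a.edge := by rw [a.ends_eq, ← ha]; exact Sym2.mem_mk_left _ _
  have h1 : B.TrailReaches r a := by
    refine ⟨⟨[a], ⟨ha, rfl⟩, by simp, by simp⟩, by simp [Trail.internal], by simp⟩
  have h2 : B.TrailReaches r a.rev := by
    refine ⟨⟨L ++ [a.rev], joins_of_isChain (by simp) hL.chain hL.start (by simp),
      hL.chain.imp fun _ _ h => h.2.1, hL.nodup⟩, ?_, by simp⟩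
    simp only [Trail.internal, dropLast_concat, mem_map, not_exists, not_and]
    intro c hc hcr
    obtain ⟨s, t, rfl⟩ := append_of_mem hc
    have hch := hL.chain
    cases t with
    | nil =>
      have : [c, a.rev].IsChain (Step r) := IsChain.right_of_append (l₁ := s) (by simpa using hch)
      rw [isChain_cons_cons] at this
      exact this.1.2.2 hcr
    | cons d t =>
      have : (c :: d :: (t ++ [a.rev])).IsChain (Step r) :=
        IsChain.right_of_append (l₁ := s) (by simpa using hch)
      rw [isChain_cons_cons] at this
      exact this.1.2.2 hcr
  have := (h a.edge hmem).unique (y₁ := a) (y₂ := a.rev) ⟨rfl, h1⟩ ⟨rfl, h2⟩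
  exact a.tail_ne_head (congrArg OrientedEdge.tail this)

lemma _root_.List.getLast?_append_cons_right {α : Type*} (A C : List α) (a : α) :
    (A ++ a :: C).getLast? = (a :: C).getLast? :=
  getLast?_append_of_ne_nil _ (by simp)

/-! ### Joining two paths at a one-way edge -/

/-- Switching from one path to another one at a common edge `s` that is reachable in one
orientation only. -/
lemma RootPath.merge {p1 p2 q1 q2 : List B.OrientedEdge} {s : B.OrientedEdge}
    (hp : RootPath r x (p1 ++ s :: p2)) (hq : RootPath r x (q1 ++ s :: q2))
    (hn : (edges (p1 ++ s :: q2)).Nodup) (hs : ¬ Reach r s.rev) :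
    ∃ W, RootPath r x W ∧ W.head? = (p1 ++ s :: p2).head? ∧
      W.getLast? = (q1 ++ s :: q2).getLast? ∧ W ⊆ p1 ++ s :: q2 := by
  have hps : RootTrail r (p1 ++ [s]) := RootTrail.of_append (M := p2) (by simpa using hp.toRootTrail)
  have hW := hps.extend hq.chain.right_of_append hn
  have hph := hp.heads_nodup
  have hqh := hq.heads_nodup
  have hpr := hp.root_notMem
  have hqr := hq.root_notMem
  have hlast : (p1 ++ s :: q2).getLast? = (q1 ++ s :: q2).getLast? := by
    rw [getLast?_append_cons_right, getLast?_append_cons_right]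
  by_cases hcap : ∃ a ∈ p1, a.head ∈ q2.map OrientedEdge.head
  -- Leaving the first path at the earliest vertex that recurs on `q2` removes all repetitions at
  -- once.
  · obtain ⟨u, e, w, rfl, he, hu⟩ := List.exists_first _ _ hcap
    obtain ⟨e', he', hee⟩ := mem_map.1 he
    obtain ⟨y, z, rfl⟩ := append_of_mem he'
    -- The first path ends in `x` only after `e`. Hence `e'` is not the last edge of the second path
    -- and has a successor `e2`.
    have hex : e.head ≠ x := by
      intro hex
      have h1 : x ∈ (s :: p2).map OrientedEdge.head := by
        have hl := getLast?_eq_getLast_of_ne_nil (cons_ne_nil s p2)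
        have h2 := hp.last _ (by rw [getLast?_append_cons_right]; exact hl)
        rw [← h2]
        exact mem_map_of_mem (mem_of_getLast? hl)
      rw [map_append, nodup_append] at hph
      exact hph.2.2 e.head (by simp) x h1 hex
    obtain ⟨e2, z, rfl⟩ : ∃ e2 z', z = e2 :: z' := by
      cases z with
      | nil => exact absurd (hee ▸ hq.last e' (by
        rw [← cons_append, ← append_assoc, getLast?_concat]; rfl)) hex
      | cons a z => exact ⟨a, z, rfl⟩
    have hcq : (s :: y ++ [e']).IsChain (Step r) ∧ (e' :: e2 :: z).IsChain (Step r) := by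
      have := hq.chain.right_of_append
      rw [← cons_append, isChain_split] at this
      exact this
    have hue : RootTrail r (u ++ [e]) :=
      RootTrail.of_append (M := w ++ s :: p2) (by simpa using hp.toRootTrail)
    have hst : Step r e' e2 := (isChain_cons_cons.1 hcq.2).1
    -- With opposite signs, `e` could be followed by `e'.rev` and then back along the second path to
    -- `s.rev`, which is unreachable. So the signs agree, and `e2` may follow `e` as it follows
    -- `e'`.
    have hsgn : B.sign e'.edge e.head = B.sign e.edge e.head := by
      by_contra hsgn
      have hsgn : B.sign e'.edge e.head = - B.sign e.edge e.head := by
        rcases Int.units_eq_one_or (B.sign e'.edge e.head) with h1 | h1 <;>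
        rcases Int.units_eq_one_or (B.sign e.edge e.head) with h2 | h2 <;> simp_all
      have hstep : Step r e e'.rev := ⟨by simpa using hee, by simpa using hsgn,
        fun h => hpr (by simp [h])⟩
      apply hs
      have hc := isChain_revList hcq.1
      have : RootTrail r (u ++ e :: revList (s :: y ++ [e'])) := by
        refine hue.extend ?_ ?_
        · simp only [revList_append, revList_cons, revList_nil, nil_append, cons_append] at hc ⊢
          exact isChain_cons_cons.2 ⟨hstep, hc⟩
        · have he : edges (u ++ e :: revList (s :: y ++ [e'])) =
            edges u ++ e.edge :: (edges (s :: y ++ [e'])).reverse := by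
              rw [← edges_revList]; simp [edges]
          have hsub : (u ++ e :: (s :: y ++ [e'])) <+
              (u ++ e :: w) ++ s :: (y ++ e' :: e2 :: z) := by
            rw [append_assoc, cons_append]
            refine (Sublist.refl u).append (Sublist.cons_cons e ?_)
            refine Sublist.trans ?_ (sublist_append_right _ _)
            exact Sublist.cons_cons s ((Sublist.refl y).append (by simp))
          rw [he, (((reverse_perm _).cons _).append_left _).nodup_iff]
          simpa [edges] using hn.sublist (hsub.map _)
      refine ⟨u ++ e :: revList (y ++ [e']), ?_⟩
      simpa using this
    have hstep : Step r e e2 := by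
      obtain ⟨h1, h2, h3⟩ := hst
      rw [hee] at h1 h2 h3
      exact ⟨h1, by rw [h2, hsgn], h3⟩
    have hsub : (u ++ e :: e2 :: z) <+ (u ++ e :: w) ++ s :: (y ++ e' :: e2 :: z) := by
      rw [append_assoc, cons_append]
      refine (Sublist.refl u).append (Sublist.cons_cons e ?_)
      refine Sublist.trans ?_ (sublist_append_right _ _)
      refine Sublist.cons s ?_
      exact (sublist_cons_self e' _).trans (sublist_append_right _ _)
    have hlast2 : (u ++ e :: e2 :: z).getLast? = (q1 ++ s :: (y ++ e' :: e2 :: z)).getLast? := by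
      have h1 : u ++ e :: e2 :: z = (u ++ [e]) ++ e2 :: z := by simp
      have h2 : q1 ++ s :: (y ++ e' :: e2 :: z) = (q1 ++ s :: (y ++ [e'])) ++ e2 :: z := by simp
      rw [h1, h2, getLast?_append_cons_right, getLast?_append_cons_right]
    refine ⟨u ++ e :: e2 :: z, ⟨hue.extend ?_ ?_, by simp, ?_, ?_, ?_⟩, ?_, ?_, hsub.subset⟩
    · exact isChain_cons_cons.2 ⟨hstep, (isChain_cons_cons.1 hcq.2).2⟩
    · exact hn.sublist (hsub.map _)
    · rw [hlast2]; exact hq.last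
    · simp only [map_append, map_cons, mem_append, mem_cons] at hpr hqr ⊢
      grind
    · have h1 : ((u ++ [e]).map OrientedEdge.head).Nodup :=
        hph.sublist (Sublist.map _ (by simp))
      have h2 : ((e' :: e2 :: z).map OrientedEdge.head).Nodup :=
        hqh.sublist (Sublist.map _ (by
          rw [← cons_append, ← append_assoc]; exact sublist_append_right _ _))
      rw [map_cons, hee] at h2
      rw [map_append, map_cons, nodup_append]
      rw [map_append, nodup_append] at h1
      refine ⟨h1.1, h2, ?_⟩
      rintro a ha b hb rfl
      obtain ⟨c, hc, rfl⟩ := mem_map.1 ha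
      refine hu c hc ?_
      rw [map_append, mem_append, map_cons, hee]
      exact Or.inr hb
    · cases u <;> simp
    · exact hlast2
  · push Not at hcap
    refine ⟨p1 ++ s :: q2, ⟨hW, by simp, ?_, ?_, ?_⟩, ?_, hlast, Subset.refl _⟩
    · rw [hlast]; exact hq.last
    · simp only [map_append, map_cons, mem_append, mem_cons] at hpr hqr ⊢
      grind
    · simp only [map_append, map_cons, nodup_append, nodup_cons, mem_cons] at hph hqh ⊢
      grind
    · cases p1 <;> simp

/-! ### The order of edges along a trail -/

lemma _root_.List.idxOf_middle {α : Type*} [DecidableEq α] {A C : List α} {a : α}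
    (h : (A ++ a :: C).Nodup) : (A ++ a :: C).idxOf a = A.length := by
  have : a ∉ A := by simp only [nodup_append, nodup_cons, mem_cons] at h; grind
  rw [idxOf_append_of_notMem this]; simp

lemma _root_.List.mem_left_iff_idxOf {α : Type*} [DecidableEq α] {A C : List α} {b : α} :
    b ∈ A ↔ (A ++ C).idxOf b < A.length := by
  constructor
  · intro h
    rw [idxOf_append_of_mem h]
    exact idxOf_lt_length_of_mem h
  · intro h
    by_contra hA
    rw [idxOf_append_of_notMem hA] at h
    omega

lemma Trail.steps_nodup {u v : V} (T : B.Trail u v) : T.steps.Nodup :=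
  T.edges_nodup.of_map _

lemma IsEdgeDisjointPaths.eq_of_edge {u v : V} {P : Set (B.Trail u v)} (hP : B.IsEdgeDisjointPaths P)
    {T T' : B.Trail u v} (hT : T ∈ P) (hT' : T' ∈ P) {a a' : B.OrientedEdge} (ha : a ∈ T.steps)
    (ha' : a' ∈ T'.steps) (h : a.edge = a'.edge) : T = T' := by
  by_contra hne
  exact Set.disjoint_left.1 (hP.2 hT hT' hne) ⟨a, ha, rfl⟩ ⟨a', ha', h.symm⟩

open Classical in
/-- `a` comes before `b` on the trail `T`, or `a = b`. -/
def Trail.Le {u v : V} (T : B.Trail u v) (a b : B.OrientedEdge) : Prop :=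
  T.steps.idxOf a ≤ T.steps.idxOf b

lemma Trail.Le.antisymm {u v : V} {T : B.Trail u v} {a b : B.OrientedEdge} (ha : a ∈ T.steps)
    (h : T.Le a b) (h' : T.Le b a) : a = b := by
  classical
  exact (idxOf_inj ha).1 (le_antisymm h h')

lemma Trail.le_iff_mem_right {u v : V} {T : B.Trail u v} {A C : List B.OrientedEdge}
    {a b : B.OrientedEdge} (hT : T.steps = A ++ a :: C) (hb : b ∈ T.steps) :
    T.Le a b ↔ b ∈ a :: C := by
  classical
  have hn := T.steps_nodup
  rw [Trail.Le, hT] at *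
  rw [idxOf_middle hn, ← not_lt, ← mem_left_iff_idxOf]
  rw [nodup_append] at hn
  constructor
  · exact fun h => (mem_append.1 hb).resolve_left h
  · exact fun h h' => hn.2.2 b h' b h rfl

lemma Trail.le_iff_mem_left {u v : V} {T : B.Trail u v} {A C : List B.OrientedEdge}
    {a b : B.OrientedEdge} (hT : T.steps = A ++ a :: C) (hb : b ∈ T.steps) :
    T.Le b a ↔ b ∈ A ∨ b = a := by
  constructor
  · intro h
    by_cases hab : b ∈ a :: C
    · exact Or.inr (Trail.Le.antisymm hb h ((le_iff_mem_right hT hb).2 hab))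
    · rw [hT] at hb
      exact Or.inl ((mem_append.1 hb).resolve_right hab)
  · rintro (h | rfl)
    · by_contra hlt
      have h1 : T.Le a b := le_of_not_ge hlt
      have hn := T.steps_nodup
      rw [le_iff_mem_right hT hb] at h1
      rw [hT, nodup_append] at hn
      exact hn.2.2 b h b h1 rfl
    · exact le_refl _

/-! ### Choosing the switching edges -/

/-- The core of the theorem: a family of switching edges, reachable in one orientation only, such
that following every path in `P` up to its switching edge and every path in `Q` from its switching
edge on, the only edges used twice are the switching edges themselves. -/
theorem exists_switching (hr : RootClean B r) {P Q : Set (B.Trail r x)}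
    (hP : B.IsEdgeDisjointPaths P) (hQ : B.IsEdgeDisjointPaths Q) (hx : x ≠ r) :
    ∃ S : Set B.OrientedEdge, (∀ s ∈ S, ¬ Reach r s.rev) ∧
      (∀ s ∈ S, ∃ T ∈ P, s ∈ T.steps) ∧ (∀ s ∈ S, ∃ T ∈ Q, s ∈ T.steps) ∧
      (∀ T ∈ P, ∀ s ∈ S, ∀ t ∈ S, s ∈ T.steps → t ∈ T.steps → s = t) ∧
      (∀ T ∈ Q, ∀ s ∈ S, ∀ t ∈ S, s ∈ T.steps → t ∈ T.steps → s = t) ∧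
      ∀ T ∈ P, ∀ T' ∈ Q, ∀ f ∈ T.steps, ∀ f' ∈ T'.steps, f.edge = f'.edge →
        (∀ s ∈ S, s ∈ T.steps → T.Le f s) → (∀ s ∈ S, s ∈ T'.steps → T'.Le s f') →
        ∃ s ∈ S, s.edge = f.edge ∧ s ∈ T.steps ∧ s ∈ T'.steps := by
  classical
  let X := {a : B.OrientedEdge //
    (∃ T ∈ P, a ∈ T.steps) ∧ (∃ T ∈ Q, a ∈ T.steps) ∧ ¬ Reach r a.rev}
  choose p hpP hp using fun a : X => a.2.1
  choose q hqQ hq using fun a : X => a.2.2.1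
  have hpe : ∀ (a : X) {T}, T ∈ P → a.1 ∈ T.steps → p a = T := fun a T hT ha =>
    hP.eq_of_edge (hpP a) hT (hp a) ha rfl
  have hqe : ∀ (a : X) {T}, T ∈ Q → a.1 ∈ T.steps → q a = T := fun a T hT ha =>
    hQ.eq_of_edge (hqQ a) hT (hq a) ha rfl
  -- Lower rank is better: early on the `P`-path, late on the `Q`-path. Truncated subtraction is
  -- harmless since the edges lie on their paths.
  obtain ⟨S, hS1, hS2, hS3⟩ := exists_stable_matching p q (fun a => (p a).steps.idxOf a.1)
    (fun a => (q a).steps.length - (q a).steps.idxOf a.1)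
    (fun s t hst h => by
      simp only [← hst] at h
      exact Subtype.ext ((idxOf_inj (hp s)).1 h))
    (fun s t hst h => by
      have h1 := idxOf_lt_length_of_mem (hq s)
      have h2 := idxOf_lt_length_of_mem (hq t)
      simp only [← hst] at h h2
      exact Subtype.ext ((idxOf_inj (hq s)).1 (by omega)))
  have hS4 : ∀ f : X, ∀ T ∈ P, ∀ T' ∈ Q, f.1 ∈ T.steps → f.1 ∈ T'.steps →
      (∃ s ∈ S, s.1 ∈ T.steps ∧ T.Le s.1 f.1) ∨ (∃ s ∈ S, s.1 ∈ T'.steps ∧ T'.Le f.1 s.1) := by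
    intro f T hT T' hT' hf hf'
    have e1 := hpe f hT hf
    have e2 := hqe f hT' hf'
    rcases hS3 f with ⟨s, hs, h1, h2⟩ | ⟨s, hs, h1, h2⟩
    · refine Or.inl ⟨s, hs, e1 ▸ h1 ▸ hp s, ?_⟩
      simp only [h1, e1] at h2
      exact h2
    · have h3 := idxOf_lt_length_of_mem (hq s)
      have h4 := idxOf_lt_length_of_mem (hq f)
      refine Or.inr ⟨s, hs, e2 ▸ h1 ▸ hq s, ?_⟩
      simp only [h1, e2] at h2 h3 h4
      rw [Trail.Le]
      omega
  refine ⟨Subtype.val '' S, ?_, ?_, ?_, ?_, ?_, ?_⟩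
  · rintro _ ⟨s, -, rfl⟩
    exact s.2.2.2
  · rintro _ ⟨s, -, rfl⟩
    exact s.2.1
  · rintro _ ⟨s, -, rfl⟩
    exact s.2.2.1
  · rintro T hT _ ⟨s, hs, rfl⟩ _ ⟨t, ht, rfl⟩ h1 h2
    rw [hS1 s hs t ht ((hpe s hT h1).trans (hpe t hT h2).symm)]
  · rintro T hT _ ⟨s, hs, rfl⟩ _ ⟨t, ht, rfl⟩ h1 h2
    rw [hS2 s hs t ht ((hqe s hT h1).trans (hqe t hT h2).symm)]
  · intro T hT T' hT' f hf f' hf' hff hfS hfS'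
    have hTp := ((hP.1 T hT).rootPath hx).toRootTrail
    have hTp' := ((hQ.1 T' hT').rootPath hx).toRootTrail
    -- A two-way `f'` has a bottleneck `b` on both paths, strictly before the clash. Stability at
    -- `b` gives a chosen edge before `f` on `T`, or one between `b` and `f'` on `T'`. The latter
    -- must be `b`, as no other edge from `b` to `f'` is one-way, and `b` also precedes `f` on `T`.
    by_cases hR : Reach r f'.rev
    · obtain ⟨L', N', hL'⟩ := append_of_mem hf
      obtain ⟨L, N, hL⟩ := append_of_mem hf'
      obtain ⟨L0, b, M, hLe, hb, hM, hbL'⟩ :=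
        exists_base hr (hL ▸ hTp') (hL' ▸ hTp) hff hR
      have hbT : b ∈ T.steps := by rw [hL']; exact mem_append_left _ hbL'
      have hbT' : b ∈ T'.steps := by rw [hL, hLe]; simp
      have hbf : ¬ T.Le f b := by
        intro h
        have := Trail.Le.antisymm hf h ((Trail.le_iff_mem_left hL' hbT).2 (Or.inl hbL'))
        have hn := T.steps_nodup
        rw [hL', nodup_append] at hn
        exact hn.2.2 b hbL' f (by simp) this.symm
      exfalso
      rcases hS4 ⟨b, ⟨T, hT, hbT⟩, ⟨T', hT', hbT'⟩, hb⟩ T hT T' hT' hbT hbT' with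
        ⟨s, hs, h1, h2⟩ | ⟨s, hs, h1, h2⟩
      · exact hbf (le_trans (hfS s.1 ⟨s, hs, rfl⟩ h1) h2)
      · have h3 := hfS' s.1 ⟨s, hs, rfl⟩ h1
        have hsb : s.1 = b := by
          have hL2 : T'.steps = L0 ++ b :: (M ++ f' :: N) := by rw [hL, hLe]; simp
          rw [Trail.le_iff_mem_left hL h1] at h3
          rcases h3 with h3 | h3
          · rw [hLe] at h3
            rcases mem_append.1 h3 with h4 | h4
            · exact Trail.Le.antisymm h1 ((Trail.le_iff_mem_left hL2 h1).2 (Or.inl h4)) h2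
            · rcases mem_cons.1 h4 with h4 | h4
              · exact h4
              · exact absurd (hM _ h4) s.2.2.2
          · exact absurd (h3 ▸ hR) s.2.2.2
        exact hbf (hsb ▸ hfS s.1 ⟨s, hs, rfl⟩ (hsb ▸ hbT))
    · have hfe : f = f' := by
        rcases eq_or_eq_rev hff with h | rfl
        · exact h
        · exact absurd (hTp.reach_of_mem hf) hR
      subst hfe
      rcases hS4 ⟨f, ⟨T, hT, hf⟩, ⟨T', hT', hf'⟩, hR⟩ T hT T' hT' hf hf' with
        ⟨s, hs, h1, h2⟩ | ⟨s, hs, h1, h2⟩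
      · have : s.1 = f := Trail.Le.antisymm h1 h2 (hfS _ ⟨s, hs, rfl⟩ h1)
        exact ⟨s.1, ⟨s, hs, rfl⟩, by rw [this], h1, this ▸ hf'⟩
      · have : s.1 = f := Trail.Le.antisymm h1 (hfS' _ ⟨s, hs, rfl⟩ h1) h2
        exact ⟨s.1, ⟨s, hs, rfl⟩, by rw [this], this ▸ hf, h1⟩

end BidirectedGraph

/-! ### Assembling the new family -/

open BidirectedGraph in
theorem mainTheorem5 {V E : Type*} (B : BidirectedGraph V E) (r x : V)
    (hclean : B.EdgeClean r) (hx : x ≠ r)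
    (P Q : Set (B.Trail r x))
    (hP : B.IsEdgeDisjointPaths P) (hQ : B.IsEdgeDisjointPaths Q) :
    ∃ R : Set (B.Trail r x), B.IsEdgeDisjointPaths R ∧
      B.firstEdges P ⊆ B.firstEdges R ∧ B.lastEdges Q ⊆ B.lastEdges R := by
  obtain ⟨S, hSr, hSP, hSQ, hSP1, hSQ1, hS⟩ := exists_switching hclean.rootClean hP hQ hx
  have key : ∀ s : S, ∃ W : B.Trail r x, W.IsPath ∧
      (∀ T ∈ P, s.1 ∈ T.steps → W.steps.head? = T.steps.head?) ∧
      (∀ T ∈ Q, s.1 ∈ T.steps → W.steps.getLast? = T.steps.getLast?) ∧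
      ∀ f ∈ W.steps, (∃ T ∈ P, s.1 ∈ T.steps ∧ f ∈ T.steps ∧ T.Le f s.1) ∨
        (∃ T ∈ Q, s.1 ∈ T.steps ∧ f ∈ T.steps ∧ T.Le s.1 f) := by
    rintro ⟨s, hs⟩
    obtain ⟨T, hT, hsT⟩ := hSP s hs
    obtain ⟨T', hT', hsT'⟩ := hSQ s hs
    obtain ⟨p1, p2, hp⟩ := List.append_of_mem hsT
    obtain ⟨q1, q2, hq⟩ := List.append_of_mem hsT'
    have hl : ∀ a ∈ p1 ++ [s], a ∈ T.steps ∧ T.Le a s := by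
      intro a ha
      have : a ∈ T.steps := by rw [hp]; simp only [List.mem_append, List.mem_cons] at ha ⊢; grind
      exact ⟨this, (Trail.le_iff_mem_left hp this).2 (by simpa using ha)⟩
    have hrt : ∀ a ∈ s :: q2, a ∈ T'.steps ∧ T'.Le s a := by
      intro a ha
      have : a ∈ T'.steps := by rw [hq]; exact List.mem_append_right _ ha
      exact ⟨this, (Trail.le_iff_mem_right hq this).2 ha⟩
    have hn : (edges (p1 ++ s :: q2)).Nodup := by
      have h1 := T.edges_nodup
      have h2 := T'.edges_nodup
      rw [hp, List.map_append, List.nodup_append] at h1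
      rw [hq, List.map_append, List.nodup_append] at h2
      rw [edges, List.map_append, List.nodup_append]
      refine ⟨h1.1, h2.2.1, ?_⟩
      rintro _ he _ he' rfl
      obtain ⟨f, hf, rfl⟩ := List.mem_map.1 he
      obtain ⟨f', hf', hff⟩ := List.mem_map.1 he'
      have hfl := hl f (List.mem_append_left _ hf)
      have hfr := hrt f' hf'
      -- An edge shared by `p1` and `s :: q2` would have to be the edge of `s`, which does not occur
      -- in `p1`.
      obtain ⟨t, ht, h3, h4, -⟩ := hS T hT T' hT' f hfl.1 f' hfr.1 hff.symm
        (fun t ht htT => hSP1 T hT s hs t ht hsT htT ▸ hfl.2)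
        (fun t ht htT => hSQ1 T' hT' s hs t ht hsT' htT ▸ hfr.2)
      have := hSP1 T hT s hs t ht hsT h4
      subst this
      exact h1.2.2 _ he _ (by simp) h3.symm
    obtain ⟨W, hW, hW1, hW2, hW3⟩ := RootPath.merge (hp ▸ (hP.1 T hT).rootPath hx)
      (hq ▸ (hQ.1 T' hT').rootPath hx) hn (hSr s hs)
    obtain ⟨W, rfl, hWp⟩ := hW.exists_trail
    refine ⟨W, hWp, ?_, ?_, ?_⟩
    · intro T1 hT1 hs1
      rw [← hP.eq_of_edge hT hT1 hsT hs1 rfl, hW1, hp]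
    · intro T1 hT1 hs1
      rw [← hQ.eq_of_edge hT' hT1 hsT' hs1 rfl, hW2, hq]
    · intro f hf
      rcases List.mem_append.1 (hW3 hf) with h | h
      · have := hl f (List.mem_append_left _ h)
        exact Or.inl ⟨T, hT, hsT, this⟩
      · exact Or.inr ⟨T', hT', hsT', hrt f h⟩
  choose W hW1 hW2 hW3 hW4 using key
  -- `own T Z`: the member `Z` of the new family replaces the path `T`
  let own : B.Trail r x → B.Trail r x → Prop := fun T Z =>
    (∃ s : S, s.1 ∈ T.steps ∧ Z = W s) ∨ (Z = T ∧ ∀ s ∈ S, s ∉ T.steps)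
  let R : Set (B.Trail r x) := {Z | ∃ T, (T ∈ P ∨ T ∈ Q) ∧ own T Z}
  have hown : ∀ T, ∃ Z, own T Z := by
    intro T
    by_cases h : ∃ s ∈ S, s ∈ T.steps
    · obtain ⟨s, hs, hsT⟩ := h
      exact ⟨W ⟨s, hs⟩, Or.inl ⟨⟨s, hs⟩, hsT, rfl⟩⟩
    · push Not at h
      exact ⟨T, Or.inr ⟨rfl, h⟩⟩
  have howns : ∀ T, T ∈ P ∨ T ∈ Q → ∀ Z, own T Z → ∀ s : S, s.1 ∈ T.steps → Z = W s := by
    rintro T hT Z (⟨t, ht, rfl⟩ | ⟨-, h⟩) s hs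
    · rcases hT with hT | hT
      · rw [Subtype.ext (hSP1 T hT s s.2 t t.2 hs ht)]
      · rw [Subtype.ext (hSQ1 T hT s s.2 t t.2 hs ht)]
    · exact absurd hs (h s s.2)
  have huniq : ∀ T, T ∈ P ∨ T ∈ Q → ∀ Z Z', own T Z → own T Z' → Z = Z' := by
    rintro T hT Z Z' h (⟨s, hs, rfl⟩ | ⟨rfl, h'⟩)
    · exact howns T hT Z h s hs
    · rcases h with ⟨s, hs, rfl⟩ | ⟨rfl, -⟩
      · exact absurd hs (h' s s.2)
      · rfl
  -- Each edge is traced to a kept piece of an old path that `Z` replaces. A shared edge of two new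
  -- paths then comes from one old path, or by `hS` from two old paths with a common switching edge;
  -- either way the new paths coincide.
  have hedges : ∀ Z ∈ R, ∀ f ∈ Z.steps,
      (∃ T ∈ P, own T Z ∧ f ∈ T.steps ∧ ∀ s ∈ S, s ∈ T.steps → T.Le f s) ∨
      (∃ T ∈ Q, own T Z ∧ f ∈ T.steps ∧ ∀ s ∈ S, s ∈ T.steps → T.Le s f) := by
    rintro Z ⟨T, hT, ⟨s, hs, rfl⟩ | ⟨rfl, h⟩⟩ f hf
    · rcases hW4 s f hf with ⟨T1, hT1, h1, h2, h3⟩ | ⟨T1, hT1, h1, h2, h3⟩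
      · exact Or.inl ⟨T1, hT1, Or.inl ⟨s, h1, rfl⟩, h2, fun t ht htT =>
          hSP1 T1 hT1 s s.2 t ht h1 htT ▸ h3⟩
      · exact Or.inr ⟨T1, hT1, Or.inl ⟨s, h1, rfl⟩, h2, fun t ht htT =>
          hSQ1 T1 hT1 s s.2 t ht h1 htT ▸ h3⟩
    · rcases hT with hT | hT
      · exact Or.inl ⟨Z, hT, Or.inr ⟨rfl, h⟩, hf, fun t ht htT => absurd htT (h t ht)⟩
      · exact Or.inr ⟨Z, hT, Or.inr ⟨rfl, h⟩, hf, fun t ht htT => absurd htT (h t ht)⟩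
  refine ⟨R, ⟨?_, ?_⟩, ?_, ?_⟩
  · rintro Z ⟨T, hT, ⟨s, hs, rfl⟩ | ⟨rfl, h⟩⟩
    · exact hW1 s
    · exact hT.elim (hP.1 Z) (hQ.1 Z)
  · intro Z hZ Z' hZ' hne
    refine Set.disjoint_left.2 ?_
    rintro e ⟨f, hf, rfl⟩ ⟨f', hf', hff⟩
    apply hne
    rcases hedges Z hZ f hf with ⟨T, hT, ho, hfT, hl⟩ | ⟨T, hT, ho, hfT, hl⟩ <;>
    rcases hedges Z' hZ' f' hf' with ⟨T', hT', ho', hfT', hl'⟩ | ⟨T', hT', ho', hfT', hl'⟩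
    · obtain rfl := hP.eq_of_edge hT hT' hfT hfT' hff.symm
      exact huniq T (Or.inl hT) Z Z' ho ho'
    · obtain ⟨s, hs, -, h1, h2⟩ := hS T hT T' hT' f hfT f' hfT' hff.symm hl hl'
      rw [howns T (Or.inl hT) Z ho ⟨s, hs⟩ h1, howns T' (Or.inr hT') Z' ho' ⟨s, hs⟩ h2]
    · obtain ⟨s, hs, -, h1, h2⟩ := hS T' hT' T hT f' hfT' f hfT hff hl' hl
      rw [howns T' (Or.inl hT') Z' ho' ⟨s, hs⟩ h1, howns T (Or.inr hT) Z ho ⟨s, hs⟩ h2]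
    · obtain rfl := hQ.eq_of_edge hT hT' hfT hfT' hff.symm
      exact huniq T (Or.inr hT) Z Z' ho ho'
  · rintro e ⟨T, hT, a, ha, rfl⟩
    obtain ⟨Z, hZ⟩ := hown T
    refine ⟨Z, ⟨T, Or.inl hT, hZ⟩, a, ?_, rfl⟩
    rcases hZ with ⟨s, hs, rfl⟩ | ⟨rfl, -⟩
    · rw [hW2 s T hT hs]; exact ha
    · exact ha
  · rintro e ⟨T, hT, a, ha, rfl⟩
    obtain ⟨Z, hZ⟩ := hown T
    refine ⟨Z, ⟨T, Or.inr hT, hZ⟩, a, ?_, rfl⟩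
    rcases hZ with ⟨s, hs, rfl⟩ | ⟨rfl, -⟩
    · rw [hW3 s T hT hs]; exact ha
    · exact ha
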